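/- Let $K^3=\{x\in[0,\infty)^3:\ x_1+x_2+x_3=1\}$ and let $\alpha_i,\beta_i,\delta_i\in\mathbb R$ ($1\le i\le 3$), $F>0$ be constants such that $D(x):=x_1\alpha_1+x_2\alpha_2(1+\beta_2)+x_3\alpha_3(1+\beta_3)\neq0$ for all $x\in K^3$, and $\alpha_1\ne0$, $\beta_1\neq0$, $\delta_2\delta_3>0$. For $x\in K^3$, $q\in\mathbb R$ put $$g(x,q)=\frac{x_1\alpha_1\beta_1q}{D(x)}+\frac{x_1\delta_1+x_2\delta_2+x_3\delta_3-x_1\alpha_1\beta_1\log F}{D(x)}.$$ Let $A=(a_{ij}):K^3\times\mathbb R\to\mathbb R^{3\times3}$ be Lipschitz, with $A(x,q)(1,1,1)'=0$, $0\le a_{ij}(x,q)\le1$ for $i\ne j$, and $1-\sum_{j\neq i}a_{ij}(x,q)\ge0$ for $1\le i\le 3$, for all $(x,q)\in K^3\times\mathbb R$. Assume that for every $\tilde x\in K^3$ both limits $A(\tilde x,\pm\infty):=\lim_{x\to\tilde x,\,q\to\pm\infty}A(x,q)$ exist; this extends $A$ to $K^3\times[-\infty,\infty]$. For $x\in K^3$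 with $x_1\ne0$ let $$q_x=\frac{x_1\alpha_1\beta_1\log F-x_1\delta_1-x_2\delta_2-x_3\delta_3}{x_1\alpha_1\beta_1},$$ and for $\tilde x\in K^3$ with $\tilde x_1=0$ let $q_{\tilde x}=\lim_{x\to\tilde x,\,x_1\ne0}q_x$ (in $[-\infty,\infty]$). Let $T(x)=A(x,q_x)'x+x$ for $x\in K^3$. Then: (a) If $x_1=0$, then $g(x,q)\ne0$ for all $q\in\mathbb R$; if $x_1\neq0$, then $g(x,q)=0$ if and only if $q=q_x$. (b) For every $\tilde x\in K^3$ with $\tilde x_1=0$ the limit defining $q_{\tilde x}$ exists and equals $+\infty$ or $-\infty$. The function $x\mapsto q_x$ is continuous from $K^3$ to $[-\infty,\infty]$, and the extended $A$ is continuous on $K^3\times[-\infty,\infty]$. (c) $T$ is a continuous map from $K^3$ to $K^3$ and has a fixed point $x^0\in K^3$; every fixed point $x^0$ of $T$ satisfies $A(x^0,q_{x^0})'x^0=0$. (d) Suppose that one of the following three conditions holds for all $\tilde x\in K^3$ with $\tilde x_1=0$ (where $q_{\tilde x}\in\{-\infty,+\infty\}$): (1) $a_{21}(\tilde x,q_{\tilde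 x})>0$ and $a_{31}(\tilde x,q_{\tilde x})>0$; (2) $a_{21}(\tilde x,q_{\tilde x})>0$ and $a_{32}(\tilde x,q_{\tilde x})>0$; (3) $a_{31}(\tilde x,q_{\tilde x})>0$ and $a_{23}(\tilde x,q_{\tilde x})>0$. Then every fixed point $x^0$ of $T$ satisfies $x^0_1>0$. (e) If $x^0$ is a fixed point of $T$ with $x^0_1>0$, then $q_{x^0}\in\mathbb R$, $A(x^0,q_{x^0})'x^0=0$ and $g(x^0,q_{x^0})=0$; that is, $(x^0,q_{x^0})$ is a fixed point (constant solution on $[0,\infty)$) of the system $\frac{dx(t)}{dt}=A(x(t),q(t))'x(t)$, $\frac{dq(t)}{dt}=g(x(t),q(t))$. -/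

import Mathlib

open Filter Topology Set
open scoped NNReal Matrix

noncomputable section

/-- The simplex `K³`; the coordinates `x₁, x₂, x₃` are `x.1 0, x.1 1, x.1 2`. -/
abbrev K3 : Type := stdSimplex ℝ (Fin 3)

/-- `x₁ α₁ + x₂ α₂ (1 + β₂) + x₃ α₃ (1 + β₃)`. -/
def priceDenom (α β : Fin 3 → ℝ) (x : K3) : ℝ :=
  x.1 0 * α 0 + x.1 1 * α 1 * (1 + β 1) + x.1 2 * α 2 * (1 + β 2)

/-- The drift `g(x, q)` of the log price, with constant coefficients. -/
def priceDrift (α β δ : Fin 3 → ℝ) (F : ℝ) (x : K3) (q : ℝ) : ℝ :=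
  x.1 0 * α 0 * β 0 * q / priceDenom α β x +
    (x.1 0 * δ 0 + x.1 1 * δ 1 + x.1 2 * δ 2 - x.1 0 * α 0 * β 0 * Real.log F) /
      priceDenom α β x

/-- The real number `q_x`, meaningful when `x₁ ≠ 0`. -/
def qReal (α β δ : Fin 3 → ℝ) (F : ℝ) (x : K3) : ℝ :=
  (x.1 0 * α 0 * β 0 * Real.log F - x.1 0 * δ 0 - x.1 1 * δ 1 - x.1 2 * δ 2) /
    (x.1 0 * α 0 * β 0)

open Classical in
/-- `q_x` on all of `K³`, extended to `x₁ = 0` as the limit (in `[-∞, ∞]`) of `q_y` as `y → x`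
with `y₁ ≠ 0`. -/
def qExt (α β δ : Fin 3 → ℝ) (F : ℝ) (x : K3) : EReal :=
  if x.1 0 = 0 then
    limUnder (𝓝[{y : K3 | y.1 0 ≠ 0}] x) (fun y => ((qReal α β δ F y : ℝ) : EReal))
  else ((qReal α β δ F x : ℝ) : EReal)

open Classical in
/-- `A` extended to `K³ × [-∞, ∞]` by `A(x, ±∞) = lim_{y → x, q → ±∞} A(y, q)`. -/
def extA (A : K3 → ℝ → Matrix (Fin 3) (Fin 3) ℝ) (x : K3) (q : EReal) :
    Matrix (Fin 3) (Fin 3) ℝ :=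
  if q = ⊤ then limUnder (𝓝 x ×ˢ atTop) (fun p : K3 × ℝ => A p.1 p.2)
  else if q = ⊥ then limUnder (𝓝 x ×ˢ atBot) (fun p : K3 × ℝ => A p.1 p.2)
  else A x q.toReal

/-- `T(x) = A(x, q_x)' x + x`. -/
def mapT (α β δ : Fin 3 → ℝ) (F : ℝ) (A : K3 → ℝ → Matrix (Fin 3) (Fin 3) ℝ) (x : K3) :
    Fin 3 → ℝ :=
  (extA A x (qExt α β δ F x))ᵀ *ᵥ x.1 + x.1

/-- `(x(t), q(t))`, `t ≥ 0`, solves `dx/dt = A(x, q)' x`, `dq/dt = g(x, q)`. -/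
def IsLimitSolution (α β δ : Fin 3 → ℝ) (F : ℝ)
    (A : K3 → ℝ → Matrix (Fin 3) (Fin 3) ℝ) (x : ℝ → K3) (q : ℝ → ℝ) : Prop :=
  ∀ t : ℝ, 0 ≤ t →
    HasDerivWithinAt (fun s => (x s).1) ((A (x t) (q t))ᵀ *ᵥ (x t).1) (Ici 0) t ∧
    HasDerivWithinAt q (priceDrift α β δ F (x t) (q t)) (Ici 0) t

/-- `(x, q)` is a fixed point of the limiting system: the constant trajectory solves it. -/
def IsLimitFixedPoint (α β δ : Fin 3 → ℝ) (F : ℝ)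
    (A : K3 → ℝ → Matrix (Fin 3) (Fin 3) ℝ) (x : K3) (q : ℝ) : Prop :=
  IsLimitSolution α β δ F A (fun _ => x) (fun _ => q)

end

/-!
The equation `g(x, q) = 0` is affine in `q` with leading coefficient `x₁ α₁ β₁ / D(x)`. On the face
`x₁ = 0` it degenerates to `x₂ δ₂ + x₃ δ₃ = 0`, which is impossible because `δ₂` and `δ₃` are
nonzero of the same sign. For the same reason `q_x = log F - (x₁ δ₁ + x₂ δ₂ + x₃ δ₃) / (x₁ α₁ β₁)`
tends to an infinity at that face (`exists_tendsto_qReal`), so that it extends continuously to the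
whole simplex with values in `[-∞, ∞]`. Likewise `A` extends continuously from the dense subspace
`K³ × ℝ` to `K³ × [-∞, ∞]`, and the closed conditions on its entries pass to the extension by
density (`extA_mem_of_isClosed`). Hence `I + A(x, q_x)` is a stochastic matrix depending
continuously on `x`, and `T` is a continuous self-map of the simplex.

The fixed point comes from Brouwer's theorem in dimension two, which is proved here with continuous
logarithms. A nowhere vanishing continuous function on the plane is the exponential of a continuous
function. If a continuous `g : ℂ → ℂ` with values in the closed unit disc had no fixed point, this
would apply to `z - g z`; on the unit circle `(z - g z) / z` lies in the right half-plane and has a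
logarithm too, so `z` itself would have a continuous logarithm on the circle, which it does not
(`not_exists_continuous_log_on_circle`). The simplex is a retract of the plane, so the theorem
carries over to it (`stdSimplex_fin_three_exists_fixedPoint`).

At a fixed point `A' x = 0`. If `x₁ = 0`, the first coordinate of this equation together with the
second or third one, under each of the positivity conditions, forces `x₂ = x₃ = 0`, contradicting
`x₁ + x₂ + x₃ = 1`.
-/

/-! ### Brouwer's theorem in the plane -/

/-- There is no continuous logarithm on the unit circle. -/
theorem not_exists_continuous_log_on_circle {ℓ : ℂ → ℂ}
    (hc : ContinuousOn ℓ (Metric.sphere 0 1))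
    (hexp : ∀ z ∈ Metric.sphere (0 : ℂ) 1, Complex.exp (ℓ z) = z) : False := by
  have hmem : ∀ t : ℝ, Complex.exp (t * Complex.I) ∈ Metric.sphere (0 : ℂ) 1 := fun t => by
    simp [Complex.norm_exp_ofReal_mul_I]
  -- `h` counts how far the angle given by `ℓ` lags behind `t`, in full turns; it is an integer.
  let h : ℝ → ℝ := fun t => ((ℓ (Complex.exp (t * Complex.I))).im - t) / (2 * Real.pi)
  have hcont : Continuous h := by
    have : Continuous fun t : ℝ => ℓ (Complex.exp (t * Complex.I)) :=
      hc.comp_continuous (by fun_prop) hmem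
    exact ((Complex.continuous_im.comp this).sub continuous_id).div_const _
  have hint : ∀ t, ∃ n : ℤ, h t = n := fun t => by
    obtain ⟨n, hn⟩ := Complex.exp_eq_exp_iff_exists_int.1 (hexp _ (hmem t))
    refine ⟨n, ?_⟩
    have him : (ℓ (Complex.exp (t * Complex.I))).im = t + n * (2 * Real.pi) := by
      rw [hn]; simp
    have := Real.pi_pos
    simp only [h, him]
    field_simp
    ring
  have hturn : h (2 * Real.pi) = h 0 - 1 := by
    have := Real.pi_pos
    simp only [h]
    push_cast
    rw [Complex.exp_two_pi_mul_I]
    simp only [zero_mul, Complex.exp_zero]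
    field_simp
    ring
  -- One turn changes `h` by `-1`, so `h` takes a value halfway between two integers.
  obtain ⟨t, ht⟩ := mem_range_of_exists_le_of_exists_ge hcont
    (⟨2 * Real.pi, by linarith⟩ : ∃ t, h t ≤ h 0 - 1 / 2) ⟨0, by linarith⟩
  obtain ⟨m, hm⟩ := hint t
  obtain ⟨n, hn⟩ := hint 0
  have h2 : ((2 * m : ℤ) : ℝ) = ((2 * n - 1 : ℤ) : ℝ) := by push_cast; linarith
  have h3 : 2 * m = 2 * n - 1 := by exact_mod_cast h2
  omega

/-- The point `1` is the only point of the closed unit disc with real part `1`. -/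
theorem Complex.re_lt_one_of_norm_le_one {u : ℂ} (hu : ‖u‖ ≤ 1) (h1 : u ≠ 1) : u.re < 1 := by
  refine lt_of_le_of_ne ((Complex.re_le_norm u).trans hu) fun hre => h1 ?_
  have hsq : u.re * u.re + u.im * u.im ≤ 1 := by
    rw [← Complex.normSq_apply, Complex.normSq_eq_norm_sq]
    nlinarith [norm_nonneg u]
  have him : u.im = 0 := by
    rw [hre] at hsq
    exact mul_self_eq_zero.1 (le_antisymm (by linarith) (mul_self_nonneg _))
  exact Complex.ext hre him

/-- Brouwer's theorem for the disc, in the form of a map defined on the whole plane. -/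
theorem Complex.exists_fixedPoint_of_norm_le_one {g : ℂ → ℂ} (hg : Continuous g)
    (hle : ∀ z, ‖g z‖ ≤ 1) : ∃ z, g z = z := by
  by_contra! hne
  have hsc : IsSimplyConnected (univ : Set ℂ) := by
    have := (convex_univ (𝕜 := ℝ) (E := ℂ)).contractibleSpace univ_nonempty
    exact inferInstanceAs (SimplyConnectedSpace (univ : Set ℂ))
  obtain ⟨L, hL, hLexp⟩ := Complex.exists_continuousOn_eqOn_exp_comp (U := (univ : Set ℂ))
    (g := fun z => z - g z) hsc isOpen_univ
    (by fun_prop) (by rintro ⟨z, -, hz⟩; exact hne z (sub_eq_zero.1 hz).symm)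
  have hz0 : ∀ z ∈ Metric.sphere (0 : ℂ) 1, z ≠ 0 := fun z hz => by
    rintro rfl; simp at hz
  have hslit : ∀ z ∈ Metric.sphere (0 : ℂ) 1, 1 - g z / z ∈ Complex.slitPlane := fun z hz => by
    have hu : ‖g z / z‖ ≤ 1 := by
      rw [norm_div, mem_sphere_zero_iff_norm.1 hz, div_one]; exact hle z
    have := Complex.re_lt_one_of_norm_le_one hu fun h => hne z ((div_eq_one_iff_eq (hz0 z hz)).1 h)
    exact Or.inl (by simpa using this)
  -- On the circle `z` is the quotient of `z - g z` by `1 - g z / z`.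
  refine not_exists_continuous_log_on_circle (ℓ := fun z => L z - Complex.log (1 - g z / z)) ?_ ?_
  · refine (hL.mono (subset_univ _)).sub (ContinuousOn.clog ?_ hslit)
    exact continuousOn_const.sub (hg.continuousOn.div continuousOn_id hz0)
  · intro z hz
    have h1 := Complex.slitPlane_ne_zero (hslit z hz)
    have h2 : Complex.exp (L z) = z - g z := hLexp (mem_univ z)
    have h3 := hz0 z hz
    have h4 : z - g z ≠ 0 := sub_ne_zero.2 (hne z).symm
    rw [Complex.exp_sub, Complex.exp_log h1, h2]
    field_simp

theorem K3.sum_eq_one (x : K3) : x.1 0 + x.1 1 + x.1 2 = 1 := by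
  simpa [Fin.sum_univ_three] using x.2.2

/-- A retraction of the plane onto the triangle `{z | 0 ≤ re z, 0 ≤ im z, re z + im z ≤ 1}`,
written in barycentric coordinates: negative coordinates are cut off and the result is rescaled. -/
noncomputable def simplexRetraction (z : ℂ) : K3 :=
  ⟨fun i => max (![z.re, z.im, 1 - z.re - z.im] i) 0 /
      (max z.re 0 + max z.im 0 + max (1 - z.re - z.im) 0), by
    have hpos : 0 < max z.re 0 + max z.im 0 + max (1 - z.re - z.im) 0 := by
      linarith [le_max_left z.re 0, le_max_left z.im 0, le_max_left (1 - z.re - z.im) 0]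
    refine ⟨fun i => div_nonneg (le_max_right _ _) hpos.le, ?_⟩
    rw [Fin.sum_univ_three]
    simp only [Matrix.cons_val]
    field_simp⟩

theorem continuous_simplexRetraction : Continuous simplexRetraction := by
  refine Continuous.subtype_mk (continuous_pi fun i => ?_) _
  refine Continuous.div ?_ (by fun_prop) fun z => ?_
  · fin_cases i <;> simp <;> fun_prop
  · refine ne_of_gt ?_
    linarith [le_max_left z.re 0, le_max_left z.im 0, le_max_left (1 - z.re - z.im) 0]

theorem simplexRetraction_mk (x : K3) : simplexRetraction ⟨x.1 0, x.1 1⟩ = x := by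
  have hsum := K3.sum_eq_one x
  have h2 : 1 - x.1 0 - x.1 1 = x.1 2 := by linarith
  refine Subtype.ext (funext fun i => ?_)
  simp only [simplexRetraction, h2, max_eq_left (x.2.1 _), hsum, div_one]
  fin_cases i <;> simp [x.2.1 _]

/-- Brouwer's theorem for the two-dimensional simplex. -/
theorem stdSimplex_fin_three_exists_fixedPoint {f : K3 → K3} (hf : Continuous f) :
    ∃ x, f x = x := by
  let π : K3 → ℂ := fun x => ⟨x.1 0, x.1 1⟩
  have hπ : Continuous π := by
    have h : π = fun x : K3 => (x.1 0 : ℂ) + (x.1 1 : ℂ) * Complex.I :=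
      funext fun x => Complex.mk_eq_add_mul_I _ _
    rw [h]
    exact (show Continuous fun v : Fin 3 → ℝ => (v 0 : ℂ) + (v 1 : ℂ) * Complex.I by
      fun_prop).comp continuous_subtype_val
  have hnorm : ∀ x, ‖π x‖ ≤ 1 := fun x => by
    have hsum := K3.sum_eq_one x
    refine (Complex.norm_le_abs_re_add_abs_im _).trans ?_
    simp only [π, abs_of_nonneg (x.2.1 _)]
    linarith [x.2.1 2]
  obtain ⟨z, hz⟩ := Complex.exists_fixedPoint_of_norm_le_one
    (hπ.comp (hf.comp continuous_simplexRetraction)) fun z => hnorm _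
  refine ⟨simplexRetraction z, ?_⟩
  have h := simplexRetraction_mk (f (simplexRetraction z))
  rw [← h]
  exact congrArg simplexRetraction hz

/-! ### The zeros of the drift -/

/-- On the face `x₁ = 0` the combination `x₂ δ₂ + x₃ δ₃` has the sign of `δ₂`. -/
theorem mul_add_mul_pos_of_face {δ : Fin 3 → ℝ} (hδ : 0 < δ 1 * δ 2) {x : K3} (hx : x.1 0 = 0) :
    0 < δ 1 * (x.1 1 * δ 1 + x.1 2 * δ 2) := by
  have hsum := K3.sum_eq_one x
  have h1 := x.2.1 1
  have h2 := x.2.1 2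
  have hd : 0 < δ 1 * δ 1 := mul_self_pos.2 fun h => by simp [h] at hδ
  have e : δ 1 * (x.1 1 * δ 1 + x.1 2 * δ 2) = x.1 1 * (δ 1 * δ 1) + x.1 2 * (δ 1 * δ 2) := by ring
  rw [e]
  rcases h1.eq_or_lt with h | h
  · have h2' : 0 < x.1 2 := by linarith
    rw [← h, zero_mul, zero_add]; positivity
  · positivity

theorem priceDrift_ne_zero_of_face {α β δ : Fin 3 → ℝ} {F : ℝ}
    (hden : ∀ x : K3, priceDenom α β x ≠ 0) (hδ : 0 < δ 1 * δ 2) {x : K3} (hx : x.1 0 = 0)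
    (q : ℝ) : priceDrift α β δ F x q ≠ 0 := by
  have h := right_ne_zero_of_mul (mul_add_mul_pos_of_face hδ hx).ne'
  simpa [priceDrift, hx, hden x] using h

theorem priceDrift_eq_zero_iff {α β δ : Fin 3 → ℝ} {F : ℝ}
    (hden : ∀ x : K3, priceDenom α β x ≠ 0) (hα : α 0 ≠ 0) (hβ : β 0 ≠ 0) {x : K3}
    (hx : x.1 0 ≠ 0) (q : ℝ) : priceDrift α β δ F x q = 0 ↔ q = qReal α β δ F x := by
  have hc : x.1 0 * α 0 * β 0 ≠ 0 := mul_ne_zero (mul_ne_zero hx hα) hβ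
  rw [priceDrift, qReal, ← add_div, div_eq_zero_iff, or_iff_left (hden x), eq_div_iff hc]
  constructor <;> intro h <;> linarith

/-! ### The extension of the log price -/

/-- Points with `x₁ ≠ 0` are dense: move towards the vertex `(1, 0, 0)`. -/
theorem dense_first_ne_zero : Dense {y : K3 | y.1 0 ≠ 0} := by
  intro x
  let e : K3 := ⟨Pi.single 0 1, single_mem_stdSimplex ℝ 0⟩
  have hmem : ∀ t : unitInterval, (1 - (t : ℝ)) • x.1 + (t : ℝ) • e.1 ∈ stdSimplex ℝ (Fin 3) :=
    fun t => convex_stdSimplex ℝ (Fin 3) x.2 e.2 (by linarith [t.2.2]) t.2.1 (by ring)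
  let γ : unitInterval → K3 := fun t => ⟨_, hmem t⟩
  have hγ : Continuous γ := by
    refine Continuous.subtype_mk ?_ _
    fun_prop
  have h0 : γ 0 = x := Subtype.ext (by simp [γ])
  have hcl : (0 : unitInterval) ∈ closure {t : unitInterval | t ≠ 0} := by
    have : (𝓝[≠] (0 : unitInterval)).NeBot := inferInstance
    exact mem_closure_iff_nhdsWithin_neBot.2 this
  rw [← h0]
  refine map_mem_closure hγ hcl fun t ht => ?_
  have htpos : 0 < (t : ℝ) := lt_of_le_of_ne t.2.1 fun h => ht (Subtype.ext h.symm)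
  have : 0 < (γ t).1 0 := by
    have h1 : 0 ≤ (1 - (t : ℝ)) * x.1 0 := mul_nonneg (by linarith [t.2.2]) (x.2.1 0)
    simp [γ, e]
    linarith
  exact this.ne'

theorem qReal_eq {α β δ : Fin 3 → ℝ} {F : ℝ} (hα : α 0 ≠ 0) (hβ : β 0 ≠ 0) {x : K3}
    (hx : x.1 0 ≠ 0) : qReal α β δ F x = Real.log F -
      (x.1 0 * δ 0 + x.1 1 * δ 1 + x.1 2 * δ 2) / (α 0 * β 0) * (x.1 0)⁻¹ := by
  rw [qReal]
  field_simp
  ring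

theorem exists_tendsto_qReal {α β δ : Fin 3 → ℝ} {F : ℝ} (hα : α 0 ≠ 0) (hβ : β 0 ≠ 0)
    (hδ : 0 < δ 1 * δ 2) {x : K3} (hx : x.1 0 = 0) :
    ∃ l : EReal, (l = ⊤ ∨ l = ⊥) ∧ Tendsto (fun y : K3 => ((qReal α β δ F y : ℝ) : EReal))
      (𝓝[{y : K3 | y.1 0 ≠ 0}] x) (𝓝 l) := by
  let N : K3 → ℝ := fun y => (y.1 0 * δ 0 + y.1 1 * δ 1 + y.1 2 * δ 2) / (α 0 * β 0)
  have hN : Tendsto N (𝓝[{y : K3 | y.1 0 ≠ 0}] x) (𝓝 (N x)) := by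
    have : Continuous N :=
      (show Continuous fun v : Fin 3 → ℝ =>
        (v 0 * δ 0 + v 1 * δ 1 + v 2 * δ 2) / (α 0 * β 0) by fun_prop).comp continuous_subtype_val
    exact (this.tendsto x).mono_left nhdsWithin_le_nhds
  have hinv : Tendsto (fun y : K3 => (y.1 0)⁻¹) (𝓝[{y : K3 | y.1 0 ≠ 0}] x) atTop := by
    refine tendsto_inv_nhdsGT_zero.comp (tendsto_nhdsWithin_iff.2 ⟨?_, ?_⟩)
    · have : Continuous fun y : K3 => y.1 0 :=
        (continuous_apply 0).comp continuous_subtype_val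
      simpa [hx] using (this.tendsto x).mono_left nhdsWithin_le_nhds
    · filter_upwards [self_mem_nhdsWithin] with y hy
      exact lt_of_le_of_ne (y.2.1 0) (Ne.symm hy)
  have hN0 : N x ≠ 0 := by
    have h := right_ne_zero_of_mul (mul_add_mul_pos_of_face hδ hx).ne'
    simp only [N, hx, zero_mul, zero_add]
    exact div_ne_zero h (mul_ne_zero hα hβ)
  have heq : ∀ᶠ y in 𝓝[{y : K3 | y.1 0 ≠ 0}] x,
      Real.log F + -(N y * (y.1 0)⁻¹) = qReal α β δ F y := by
    filter_upwards [self_mem_nhdsWithin] with y hy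
    rw [qReal_eq hα hβ hy, sub_eq_add_neg]
  rcases hN0.lt_or_gt with h | h
  · refine ⟨⊤, Or.inl rfl, EReal.tendsto_coe_nhds_top_iff.2 (Tendsto.congr' heq ?_)⟩
    exact tendsto_atTop_add_const_left _ _ (tendsto_neg_atBot_atTop.comp (hN.neg_mul_atTop h hinv))
  · refine ⟨⊥, Or.inr rfl, EReal.tendsto_coe_nhds_bot_iff.2 (Tendsto.congr' heq ?_)⟩
    exact tendsto_atBot_add_const_left _ _ (tendsto_neg_atTop_atBot.comp (hN.pos_mul_atTop h hinv))

theorem qExt_face {α β δ : Fin 3 → ℝ} {F : ℝ} (hα : α 0 ≠ 0) (hβ : β 0 ≠ 0)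
    (hδ : 0 < δ 1 * δ 2) {x : K3} (hx : x.1 0 = 0) :
    (qExt α β δ F x = ⊤ ∨ qExt α β δ F x = ⊥) ∧
      Tendsto (fun y : K3 => ((qReal α β δ F y : ℝ) : EReal))
        (𝓝[{y : K3 | y.1 0 ≠ 0}] x) (𝓝 (qExt α β δ F x)) := by
  obtain ⟨l, hl, ht⟩ := exists_tendsto_qReal (F := F) hα hβ hδ hx
  have := mem_closure_iff_nhdsWithin_neBot.1 (dense_first_ne_zero x)
  have h : qExt α β δ F x = l := by rw [qExt, if_pos hx, ht.limUnder_eq]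
  rw [h]
  exact ⟨hl, ht⟩

theorem qExt_of_ne_zero {α β δ : Fin 3 → ℝ} {F : ℝ} {x : K3} (hx : x.1 0 ≠ 0) :
    qExt α β δ F x = ((qReal α β δ F x : ℝ) : EReal) := if_neg hx

theorem continuous_qExt {α β δ : Fin 3 → ℝ} {F : ℝ} (hα : α 0 ≠ 0) (hβ : β 0 ≠ 0)
    (hδ : 0 < δ 1 * δ 2) : Continuous (qExt α β δ F) := by
  have hc : ContinuousOn (fun y : K3 => ((qReal α β δ F y : ℝ) : EReal))
      {y : K3 | y.1 0 ≠ 0} := by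
    refine continuous_coe_real_ereal.comp_continuousOn (ContinuousOn.div ?_ ?_ ?_)
    · exact ((show Continuous fun v : Fin 3 → ℝ => v 0 * α 0 * β 0 * Real.log F - v 0 * δ 0 -
        v 1 * δ 1 - v 2 * δ 2 by fun_prop).comp continuous_subtype_val).continuousOn
    · exact ((show Continuous fun v : Fin 3 → ℝ => v 0 * α 0 * β 0 by
        fun_prop).comp continuous_subtype_val).continuousOn
    · exact fun y hy => mul_ne_zero (mul_ne_zero hy hα) hβ
  have heq : qExt α β δ F =
      extendFrom {y : K3 | y.1 0 ≠ 0} fun y => ((qReal α β δ F y : ℝ) : EReal) := by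
    funext x
    by_cases hx : x.1 0 = 0
    · exact (extendFrom_eq (dense_first_ne_zero x) (qExt_face hα hβ hδ hx).2).symm
    · rw [extendFrom_extends hc x hx, qExt_of_ne_zero hx]
  rw [heq]
  refine continuous_extendFrom dense_first_ne_zero fun x => ?_
  by_cases hx : x.1 0 = 0
  · exact ⟨_, (qExt_face hα hβ hδ hx).2⟩
  · exact ⟨_, hc x hx⟩

/-! ### The extension of the matrix -/

theorem EReal.comap_coe_nhds_top : comap Real.toEReal (𝓝 ⊤) = atTop := by
  refine le_antisymm ?_ (map_le_iff_le_comap.1 EReal.tendsto_coe_atTop)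
  exact EReal.tendsto_coe_nhds_top_iff.1 tendsto_comap

theorem EReal.comap_coe_nhds_bot : comap Real.toEReal (𝓝 ⊥) = atBot := by
  refine le_antisymm ?_ (map_le_iff_le_comap.1 EReal.tendsto_coe_atBot)
  exact EReal.tendsto_coe_nhds_bot_iff.1 tendsto_comap

theorem isDenseInducing_prodMap_id_coe_ereal (X : Type*) [TopologicalSpace X] :
    IsDenseInducing (Prod.map id Real.toEReal : X × ℝ → X × EReal) := by
  have h : IsDenseInducing Real.toEReal := by
    refine ⟨EReal.isEmbedding_coe.isInducing, fun q => ?_⟩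
    induction q with
    | bot =>
      exact mem_closure_of_tendsto EReal.tendsto_coe_atBot (Eventually.of_forall mem_range_self)
    | coe r => exact subset_closure (mem_range_self r)
    | top =>
      exact mem_closure_of_tendsto EReal.tendsto_coe_atTop (Eventually.of_forall mem_range_self)
  exact IsDenseInducing.prodMap ⟨IsInducing.id, denseRange_id⟩ h

/-- `extA A` gives the limits of `A` along the filters that `K³ × [-∞, ∞]` induces on the dense
subspace `K³ × ℝ`. -/
theorem tendsto_extA {A : K3 → ℝ → Matrix (Fin 3) (Fin 3) ℝ}
    (hA : Continuous fun p : K3 × ℝ => A p.1 p.2)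
    (htop : ∀ x : K3, ∃ L : Matrix (Fin 3) (Fin 3) ℝ,
      Tendsto (fun p : K3 × ℝ => A p.1 p.2) (𝓝 x ×ˢ atTop) (𝓝 L))
    (hbot : ∀ x : K3, ∃ L : Matrix (Fin 3) (Fin 3) ℝ,
      Tendsto (fun p : K3 × ℝ => A p.1 p.2) (𝓝 x ×ˢ atBot) (𝓝 L)) (p : K3 × EReal) :
    Tendsto (fun p : K3 × ℝ => A p.1 p.2)
      (comap (Prod.map id Real.toEReal) (𝓝 p)) (𝓝 (extA A p.1 p.2)) := by
  obtain ⟨x, q⟩ := p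
  have h : comap (Prod.map id Real.toEReal) (𝓝 (x, q)) = 𝓝 x ×ˢ comap Real.toEReal (𝓝 q) := by
    rw [nhds_prod_eq]
    exact prod_comap_comap_eq.symm.trans (by rw [comap_id])
  rw [h]
  induction q with
  | bot =>
    rw [EReal.comap_coe_nhds_bot]
    simpa [extA] using tendsto_nhds_limUnder (hbot x)
  | coe r =>
    rw [← EReal.isEmbedding_coe.isInducing.nhds_eq_comap, ← nhds_prod_eq]
    simpa [extA] using hA.tendsto (x, r)
  | top =>
    rw [EReal.comap_coe_nhds_top]
    simpa [extA] using tendsto_nhds_limUnder (htop x)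

theorem continuous_extA {A : K3 → ℝ → Matrix (Fin 3) (Fin 3) ℝ}
    (hlim : ∀ p : K3 × EReal, Tendsto (fun p : K3 × ℝ => A p.1 p.2)
      (comap (Prod.map id Real.toEReal) (𝓝 p)) (𝓝 (extA A p.1 p.2))) :
    Continuous fun p : K3 × EReal => extA A p.1 p.2 := by
  have di := isDenseInducing_prodMap_id_coe_ereal K3
  have heq : (fun p : K3 × EReal => extA A p.1 p.2) = di.extend fun p : K3 × ℝ => A p.1 p.2 :=
    funext fun p => (di.extend_eq_of_tendsto (hlim p)).symm
  rw [heq]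
  exact di.continuous_extend fun p => ⟨_, hlim p⟩

theorem extA_mem_of_isClosed {A : K3 → ℝ → Matrix (Fin 3) (Fin 3) ℝ}
    (hlim : ∀ p : K3 × EReal, Tendsto (fun p : K3 × ℝ => A p.1 p.2)
      (comap (Prod.map id Real.toEReal) (𝓝 p)) (𝓝 (extA A p.1 p.2)))
    {S : Set (Matrix (Fin 3) (Fin 3) ℝ)} (hS : IsClosed S) (hmem : ∀ x q, A x q ∈ S)
    (x : K3) (q : EReal) : extA A x q ∈ S := by
  have := (isDenseInducing_prodMap_id_coe_ereal K3).comap_nhds_neBot (x, q)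
  exact hS.mem_of_tendsto (hlim (x, q)) (Eventually.of_forall fun p => hmem p.1 p.2)

/-- The matrices `M` for which `I + M` is stochastic. -/
def generatorSet : Set (Matrix (Fin 3) (Fin 3) ℝ) :=
  {M | (∀ i j, 0 ≤ M i j + (1 : Matrix (Fin 3) (Fin 3) ℝ) i j) ∧ ∀ i, ∑ j, M i j = 0}

theorem isClosed_generatorSet : IsClosed generatorSet := by
  have h : generatorSet =
      (⋂ i, ⋂ j, {M | 0 ≤ M i j + (1 : Matrix (Fin 3) (Fin 3) ℝ) i j}) ∩
        ⋂ i, {M | ∑ j, M i j = 0} := by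
    ext M; simp [generatorSet]
  have hentry : ∀ i j, Continuous fun M : Matrix (Fin 3) (Fin 3) ℝ => M i j :=
    fun i j => continuous_id.matrix_elem i j
  rw [h]
  refine IsClosed.inter (isClosed_iInter fun i => isClosed_iInter fun j =>
    isClosed_le continuous_const ((hentry i j).add continuous_const)) (isClosed_iInter fun i =>
    isClosed_eq (continuous_finsetSum _ fun j _ => hentry i j) continuous_const)

theorem transpose_mulVec_add_mem_stdSimplex {M : Matrix (Fin 3) (Fin 3) ℝ} (hM : M ∈ generatorSet)
    (x : K3) : Mᵀ *ᵥ x.1 + x.1 ∈ stdSimplex ℝ (Fin 3) := by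
  obtain ⟨hpos, hsum⟩ := hM
  constructor
  · intro j
    have h : (Mᵀ *ᵥ x.1 + x.1) j =
        ∑ i, (M i j + (1 : Matrix (Fin 3) (Fin 3) ℝ) i j) * x.1 i := by
      simp [Matrix.mulVec, dotProduct, add_mul, Finset.sum_add_distrib, Matrix.one_apply]
    rw [h]
    exact Finset.sum_nonneg fun i _ => mul_nonneg (hpos i j) (x.2.1 i)
  · have h : ∑ j, (Mᵀ *ᵥ x.1) j = 0 := by
      simp only [Matrix.mulVec, dotProduct, Matrix.transpose_apply]
      rw [Finset.sum_comm]
      simp [← Finset.sum_mul, hsum]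
    simp only [Pi.add_apply, Finset.sum_add_distrib, h, zero_add]
    exact x.2.2

/-! ### Fixed points -/

/-- If `M' x = 0` and `x₁ = 0`, the first coordinate gives `m₂₁ x₂ = m₃₁ x₃ = 0`, as both terms are
nonnegative. Under each positivity condition this and a second coordinate force `x = 0`, which is
not in the simplex. -/
theorem first_ne_zero_of_transpose_mulVec_eq_zero {M : Matrix (Fin 3) (Fin 3) ℝ} {x : K3}
    (h0 : Mᵀ *ᵥ x.1 = 0) (hM1 : 0 ≤ M 1 0) (hM2 : 0 ≤ M 2 0)
    (hM : (0 < M 1 0 ∧ 0 < M 2 0) ∨ (0 < M 1 0 ∧ 0 < M 2 1) ∨ (0 < M 2 0 ∧ 0 < M 1 2)) :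
    x.1 0 ≠ 0 := by
  intro hx
  have hsum := K3.sum_eq_one x
  have hx1 := x.2.1 1
  have hx2 := x.2.1 2
  have e : ∀ j, M 1 j * x.1 1 + M 2 j * x.1 2 = 0 := fun j => by
    simpa [Matrix.mulVec, dotProduct, Fin.sum_univ_three, hx] using congrFun h0 j
  have n1 : 0 ≤ M 1 0 * x.1 1 := mul_nonneg hM1 hx1
  have n2 : 0 ≤ M 2 0 * x.1 2 := mul_nonneg hM2 hx2
  have e1 : M 1 0 * x.1 1 = 0 := by linarith [e 0]
  have e2 : M 2 0 * x.1 2 = 0 := by linarith [e 0]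
  rcases hM with ⟨ha, hb⟩ | ⟨ha, hb⟩ | ⟨ha, hb⟩
  · have h1 := (mul_eq_zero.1 e1).resolve_left ha.ne'
    have h2 := (mul_eq_zero.1 e2).resolve_left hb.ne'
    linarith
  · have h1 := (mul_eq_zero.1 e1).resolve_left ha.ne'
    have h2 := e 1
    rw [h1, mul_zero, zero_add] at h2
    have h3 := (mul_eq_zero.1 h2).resolve_left hb.ne'
    linarith
  · have h1 := (mul_eq_zero.1 e2).resolve_left ha.ne'
    have h2 := e 2
    rw [h1, mul_zero, add_zero] at h2
    have h3 := (mul_eq_zero.1 h2).resolve_left hb.ne'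
    linarith

theorem mainTheorem6
    (α β δ : Fin 3 → ℝ) (F : ℝ) (A : K3 → ℝ → Matrix (Fin 3) (Fin 3) ℝ)
    (hF : 0 < F)
    (hden : ∀ x : K3, priceDenom α β x ≠ 0)
    (hα : α 0 ≠ 0) (hβ : β 0 ≠ 0) (hδ : 0 < δ 1 * δ 2)
    (hrow : ∀ (x : K3) (q : ℝ), A x q *ᵥ (fun _ => (1 : ℝ)) = 0)
    (hoff : ∀ (x : K3) (q : ℝ) (i j : Fin 3), i ≠ j → 0 ≤ A x q i j ∧ A x q i j ≤ 1)
    (hdiag : ∀ (x : K3) (q : ℝ) (i : Fin 3),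
      0 ≤ 1 - ∑ j ∈ Finset.univ.erase i, A x q i j)
    (hLip : ∃ C : ℝ≥0, ∀ i j : Fin 3, LipschitzWith C (fun p : K3 × ℝ => A p.1 p.2 i j))
    (htop : ∀ x : K3, ∃ L : Matrix (Fin 3) (Fin 3) ℝ,
      Tendsto (fun p : K3 × ℝ => A p.1 p.2) (𝓝 x ×ˢ atTop) (𝓝 L))
    (hbot : ∀ x : K3, ∃ L : Matrix (Fin 3) (Fin 3) ℝ,
      Tendsto (fun p : K3 × ℝ => A p.1 p.2) (𝓝 x ×ˢ atBot) (𝓝 L)) :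
    -- solutions of `g(x, q) = 0`
    (∀ x : K3, x.1 0 = 0 → ∀ q : ℝ, priceDrift α β δ F x q ≠ 0) ∧
    (∀ x : K3, x.1 0 ≠ 0 → ∀ q : ℝ,
      priceDrift α β δ F x q = 0 ↔ q = qReal α β δ F x) ∧
    -- the extension of `q_x` to `x₁ = 0`
    (∀ x : K3, x.1 0 = 0 →
      (qExt α β δ F x = ⊤ ∨ qExt α β δ F x = ⊥) ∧
      Tendsto (fun y : K3 => ((qReal α β δ F y : ℝ) : EReal))
        (𝓝[{y : K3 | y.1 0 ≠ 0}] x) (𝓝 (qExt α β δ F x))) ∧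
    Continuous (qExt α β δ F) ∧
    -- the extension of `A`
    Continuous (fun p : K3 × EReal => extA A p.1 p.2) ∧
    -- `T` is a continuous map from `K³` to `K³` with a fixed point
    (∀ x : K3, mapT α β δ F A x ∈ stdSimplex ℝ (Fin 3)) ∧
    Continuous (mapT α β δ F A) ∧
    (∃ x : K3, mapT α β δ F A x = x.1) ∧
    (∀ x : K3, mapT α β δ F A x = x.1 → (extA A x (qExt α β δ F x))ᵀ *ᵥ x.1 = 0) ∧
    -- each of the three boundary conditions forces `x₁ > 0` at every fixed point of `T`
    (((∀ x : K3, x.1 0 = 0 →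
        0 < extA A x (qExt α β δ F x) 1 0 ∧ 0 < extA A x (qExt α β δ F x) 2 0) ∨
      (∀ x : K3, x.1 0 = 0 →
        0 < extA A x (qExt α β δ F x) 1 0 ∧ 0 < extA A x (qExt α β δ F x) 2 1) ∨
      (∀ x : K3, x.1 0 = 0 →
        0 < extA A x (qExt α β δ F x) 2 0 ∧ 0 < extA A x (qExt α β δ F x) 1 2)) →
      ∀ x : K3, mapT α β δ F A x = x.1 → 0 < x.1 0) ∧
    -- a fixed point of `T` with `x₁ > 0` gives a fixed point of the limiting system
    (∀ x : K3, mapT α β δ F A x = x.1 → 0 < x.1 0 →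
      qExt α β δ F x = ((qReal α β δ F x : ℝ) : EReal) ∧
      (A x (qReal α β δ F x))ᵀ *ᵥ x.1 = 0 ∧
      priceDrift α β δ F x (qReal α β δ F x) = 0 ∧
      IsLimitFixedPoint α β δ F A x (qReal α β δ F x)) := by
  obtain ⟨C, hC⟩ := hLip
  have hAc : Continuous fun p : K3 × ℝ => A p.1 p.2 :=
    continuous_matrix fun i j => (hC i j).continuous
  have hlim := tendsto_extA hAc htop hbot
  have hq : Continuous (qExt α β δ F) := continuous_qExt hα hβ hδ
  have hextc := continuous_extA hlim
  have hAgen : ∀ x q, A x q ∈ generatorSet := fun x q => by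
    have hsum : ∀ i, ∑ j, A x q i j = 0 := fun i => by
      simpa [Matrix.mulVec, dotProduct] using congrFun (hrow x q) i
    refine ⟨fun i j => ?_, hsum⟩
    rcases eq_or_ne i j with rfl | hij
    · have h1 := Finset.add_sum_erase Finset.univ (fun j => A x q i j) (Finset.mem_univ i)
      have h2 := hdiag x q i
      have h3 := hsum i
      rw [Matrix.one_apply_eq]
      linarith
    · rw [Matrix.one_apply_ne hij, add_zero]
      exact (hoff x q i j hij).1
  have hgen := extA_mem_of_isClosed hlim isClosed_generatorSet hAgen
  have hT : ∀ x, mapT α β δ F A x ∈ stdSimplex ℝ (Fin 3) := fun x =>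
    transpose_mulVec_add_mem_stdSimplex (hgen x _) x
  have hTc : Continuous (mapT α β δ F A) := by
    have h1 : Continuous fun x => extA A x (qExt α β δ F x) :=
      hextc.comp (continuous_id.prodMk hq)
    exact (h1.matrix_transpose.matrix_mulVec continuous_subtype_val).add continuous_subtype_val
  have hfix : ∀ x : K3, mapT α β δ F A x = x.1 →
      (extA A x (qExt α β δ F x))ᵀ *ᵥ x.1 = 0 := fun x hx => by
    simpa [mapT] using hx
  refine ⟨fun x hx q => priceDrift_ne_zero_of_face hden hδ hx q,
    fun x hx q => priceDrift_eq_zero_iff hden hα hβ hx q,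
    fun x hx => qExt_face hα hβ hδ hx, hq, hextc, hT, hTc, ?_, hfix, ?_, ?_⟩
  · obtain ⟨x, hx⟩ := stdSimplex_fin_three_exists_fixedPoint (hTc.subtype_mk hT)
    exact ⟨x, congrArg Subtype.val hx⟩
  · intro hcond x hx
    refine lt_of_le_of_ne (x.2.1 0) fun h => ?_
    have hnn : ∀ i j, i ≠ j → 0 ≤ extA A x (qExt α β δ F x) i j := fun i j hij => by
      simpa [Matrix.one_apply_ne hij] using (hgen x (qExt α β δ F x)).1 i j
    exact first_ne_zero_of_transpose_mulVec_eq_zero (hfix x hx) (hnn 1 0 (by decide))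
      (hnn 2 0 (by decide))
      (hcond.imp (fun H => H x h.symm) (Or.imp (fun H => H x h.symm) fun H => H x h.symm)) h.symm
  · intro x hx hpos
    have hqx : qExt α β δ F x = ((qReal α β δ F x : ℝ) : EReal) := qExt_of_ne_zero hpos.ne'
    have hA0 : (A x (qReal α β δ F x))ᵀ *ᵥ x.1 = 0 := by
      have := hfix x hx
      rw [hqx] at this
      simpa [extA] using this
    have hg0 := (priceDrift_eq_zero_iff (F := F) (δ := δ) hden hα hβ hpos.ne' _).2 rfl
    refine ⟨hqx, hA0, hg0, fun t _ => ⟨?_, ?_⟩⟩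
    · rw [hA0]; exact hasDerivWithinAt_const _ _ _
    · rw [hg0]; exact hasDerivWithinAt_const _ _ _
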